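/- Let $\mathbb R_+=(0,\infty)$, let $\mathcal H=L^2(\mathbb R_+,e^{-x}\,dx)$ (real or complex scalars), and for $f\in\mathcal H$ let $$Tf(x)=f(x)-\int_0^x f(y)\,dy .$$ Let $$L_n(x)=\sum_{k=0}^n\binom nk\frac{(-1)^k}{k!}x^k,\qquad n=0,1,2,\dots,$$ be the Laguerre polynomials. Then $T$ is a well-defined linear isometry of $\mathcal H$ into itself, $\{L_n\}_{n\ge0}$ is an orthonormal basis of $\mathcal H$, and $T$ is the unilateral shift on this basis, that is, $TL_n=L_{n+1}$ for all $n\ge 0$. Moreover, if $f\in\mathcal H$ has absolutely summable Laguerre coefficients, that is, $$\sum_{n=0}^\infty\left|\int_0^\infty f(x)L_n(x)e^{-x}\,dx\right|<\infty ,$$ then for every $\eta>0$ and for almost every $x\in\mathbb R_+$, $$\lim_{N\to\infty}\frac{\sqrt N}{(\log(1+N))^{\frac32+\eta}}\left|\frac1N\sum_{n=0}^{N-1}T^nf(x)\right|=0 .$$ -/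

import Mathlib

open MeasureTheory Filter Topology

/-- The measure `e^{-x} dx` on the half-line `ℝ₊ = (0, ∞)`, seen as a measure on `ℝ`. -/
noncomputable def laguerreMeasure : Measure ℝ :=
  (volume.restrict (Set.Ioi (0 : ℝ))).withDensity (fun x => ENNReal.ofReal (Real.exp (-x)))

/-- The `n`-th Laguerre polynomial `L_n(x) = ∑_{k=0}^n (n choose k) (-1)^k / k! x^k`. -/
noncomputable def laguerreL (n : ℕ) (x : ℝ) : ℝ :=
  ∑ k ∈ Finset.range (n + 1), (n.choose k : ℝ) * ((-1) ^ k / (k.factorial : ℝ)) * x ^ k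

/-- The operator `Tf(x) = f(x) - ∫_0^x f(y) dy`, on functions. Only the values at `x > 0` matter,
since `laguerreMeasure` gives no mass to `(-∞, 0]`. -/
noncomputable def laguerreT {𝕜 : Type*} [RCLike 𝕜] (f : ℝ → 𝕜) (x : ℝ) : 𝕜 :=
  f x - ∫ y in (0 : ℝ)..x, f y

/-- The `n`-th Laguerre coefficient `∫_0^∞ f(x) L_n(x) e^{-x} dx` of `f`. -/
noncomputable def laguerreCoeff {𝕜 : Type*} [RCLike 𝕜] (f : ℝ → 𝕜) (n : ℕ) : 𝕜 :=
  ∫ x, f x * (laguerreL n x : 𝕜) ∂laguerreMeasure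

/-! The sequence `u n = L_n(x)`, with `e n = n (L_n(x) - L_{n-1}(x))`, is a discrete oscillator: `e
(n+1) = e n - x u n` and `(n+1)(u (n+1) - u n) = e (n+1)`. An energy estimate gives `u n =
O(n^{-1/4})` and `e n = O(n^{1/4})` for fixed `x > 0`. Telescoping `e` on early windows and using
the decay of `u` on late ones bounds every window sum of length `N` by `C √N`, uniformly in its
position (`laguerreL_sum_bound`). If `f = ∑ a_k L_k` with `a` absolutely summable, then `T^n f = ∑
a_k L_{k+n}` almost everywhere, so the averages are `O(N^{-1/2})` and any positive power of the
logarithm suffices. On the Hilbert space side, orthonormality comes from integration by parts and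
completeness from determinacy of moments. The shift is defined abstractly and then identified with
`T` (`laguerreShift_ae_eq_laguerreT`), which gives boundedness and isometry of `T` together. -/

/-! ### Energy estimates for a discrete oscillator -/

/-- With `s = √n` and `t = √(n+1)`, a damping of `1/(2(n+1))` per step is the decay rate of
`n^{-1/2}`. The weight `√n` cancels it up to a summable `O(n^{-3/2})`. -/
lemma weighted_le_of_le_damped {s t A A' E K : ℝ} (hs : 1 ≤ s) (ht : 0 ≤ t)
    (hts : t ^ 2 = s ^ 2 + 1) (hK0 : 0 ≤ K) (hA0 : 0 ≤ A) (hEA : E ≤ 2 * A)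
    (herr : A' ≤ (1 - 1 / (2 * t ^ 2)) * A + K / s ^ 3 * E) :
    t * A' ≤ (1 + (1 + 4 * K) / s ^ 3) * (s * A) := by
  have hs0 : 0 < s := by linarith
  have ht1 : 1 ≤ t := by nlinarith
  have ht0 : 0 < t := by linarith
  have ht2s : t ≤ 2 * s := by nlinarith
  have hmain : t * (1 - 1 / (2 * t ^ 2)) ≤ s * (1 + 1 / s ^ 3) := by
    have h1 : 0 ≤ s * (1 + 1 / s ^ 3) := by positivity
    apply le_of_sq_le_sq _ h1
    have e1 : (t * (1 - 1 / (2 * t ^ 2))) ^ 2 = s ^ 2 + 1 / (4 * t ^ 2) := by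
      have : s ^ 2 = t ^ 2 - 1 := by linarith
      rw [this]; field_simp; ring
    have e2 : (s * (1 + 1 / s ^ 3)) ^ 2 = s ^ 2 + 2 / s + 1 / s ^ 4 := by field_simp; ring
    have e3 : 1 / (4 * t ^ 2) ≤ 2 / s := by
      rw [div_le_div_iff₀ (by positivity) (by positivity)]; nlinarith
    have e4 : 0 ≤ 1 / s ^ 4 := by positivity
    rw [e1, e2]; linarith
  calc t * A' ≤ t * ((1 - 1 / (2 * t ^ 2)) * A + K / s ^ 3 * E) := by gcongr
    _ = (t * (1 - 1 / (2 * t ^ 2))) * A + t * (K / s ^ 3 * E) := by ring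
    _ ≤ (s * (1 + 1 / s ^ 3)) * A + t * (K / s ^ 3 * (2 * A)) := by gcongr
    _ ≤ (s * (1 + 1 / s ^ 3)) * A + (2 * s) * (K / s ^ 3 * (2 * A)) := by gcongr
    _ = (1 + (1 + 4 * K) / s ^ 3) * (s * A) := by ring

/-- One step of the energy estimate for the discrete oscillator. -/
lemma oscillator_energy_step {x s t u e u' e' : ℝ} (hx : 0 < x) (hs : 1 ≤ s) (ht : 0 ≤ t)
    (hts : t ^ 2 = s ^ 2 + 1) (hκ : (1 / 2 - x) ^ 2 ≤ x * s ^ 2)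
    (he' : e' = e - x * u) (hu' : t ^ 2 * (u' - u) = e') :
    let κ := 1 / 2 - x
    let A := x * u ^ 2 + e ^ 2 / s ^ 2 + κ * u * e / s ^ 2
    let A' := x * u' ^ 2 + e' ^ 2 / t ^ 2 + κ * u' * e' / t ^ 2
    x * u ^ 2 + e ^ 2 / s ^ 2 ≤ 2 * A ∧
      t * A' ≤ (1 + (1 + 4 * (x / 2 + (x + |κ|) / (2 * √x))) / s ^ 3) * (s * A) := by
  intro κ A A'
  set E := x * u ^ 2 + e ^ 2 / s ^ 2 with hE
  have hs0 : 0 < s := by linarith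
  have ht1 : 1 ≤ t := by nlinarith
  have ht0 : 0 < t := by linarith
  have hr : 0 < √x := Real.sqrt_pos.2 hx
  have hrx : √x ^ 2 = x := Real.sq_sqrt hx.le
  have hE0 : 0 ≤ E := by positivity
  have hue : |u * e| ≤ s * E / (2 * √x) := by
    rw [le_div_iff₀ (by positivity)]
    have h1 : s * E = (√x * |u|) ^ 2 * s + |e| ^ 2 / s := by
      rw [hE, mul_pow, hrx, sq_abs, sq_abs]; field_simp
    have h2 : (√x * |u|) ^ 2 * s + |e| ^ 2 / s - 2 * (√x * |u|) * |e|
        = (√x * |u| * s - |e|) ^ 2 / s := by field_simp; ring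
    have h3 : 0 ≤ (√x * |u| * s - |e|) ^ 2 / s := by positivity
    rw [abs_mul]; nlinarith
  have hκs : |κ| ≤ √x * s := by
    apply abs_le_of_sq_le_sq _ (by positivity)
    rw [mul_pow, hrx]; exact hκ
  have hEA : E ≤ 2 * A := by
    have h1 : |κ * u * e / s ^ 2| ≤ E / 2 := by
      rw [abs_div, mul_assoc, abs_mul κ, abs_of_pos (by positivity : 0 < s ^ 2),
        div_le_iff₀ (by positivity)]
      calc |κ| * |u * e| ≤ (√x * s) * (s * E / (2 * √x)) := by gcongr
        _ = E / 2 * s ^ 2 := by field_simp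
    have := (abs_le.1 h1).1
    have hA : A = E + κ * u * e / s ^ 2 := rfl
    linarith
  refine ⟨hEA, ?_⟩
  have hA0 : 0 ≤ A := by linarith
  have hst : s ≤ t := by nlinarith
  -- To leading order the terms `x u²` and `e²/s²` alone are damped at relative rates `x/t²` and
  -- `(1-x)/t²`. The cross term with `κ = 1/2 - x` shifts both rates to `1/(2t²)`; what is left is
  -- of lower order.
  have hid : A' = (1 - 1 / (2 * t ^ 2)) * A + x ^ 2 * u ^ 2 / (2 * t ^ 4)
      - e ^ 2 / (2 * t ^ 4 * s ^ 2) - (u * e) * (x / t ^ 4 + κ / (2 * t ^ 2 * s ^ 2)) := by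
    have hs2 : s ^ 2 ≠ 0 := by positivity
    have h4 : t ^ 4 = (s ^ 2 + 1) ^ 2 := by rw [← hts]; ring
    have h0 : s ^ 2 + 1 ≠ 0 := by positivity
    have hue' : u' = u + (e - x * u) / (s ^ 2 + 1) := by
      rw [← he', ← hu', ← hts]; field_simp; ring
    simp only [A', A, hue', he', κ, h4, hts]
    field_simp
    ring
  set K := x / 2 + (x + |κ|) / (2 * √x) with hK
  have hK0 : 0 ≤ K := by positivity
  have herr : A' ≤ (1 - 1 / (2 * t ^ 2)) * A + K / s ^ 3 * E := by
    have h1 : x ^ 2 * u ^ 2 / (2 * t ^ 4) ≤ x / 2 / s ^ 3 * E := by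
      have ha : x * u ^ 2 ≤ E := by rw [hE]; have : 0 ≤ e ^ 2 / s ^ 2 := by positivity
                                    linarith
      have hb : s ^ 3 ≤ t ^ 4 := calc
        s ^ 3 ≤ t ^ 3 := by gcongr
        _ ≤ t ^ 4 := pow_le_pow_right₀ ht1 (by norm_num)
      calc x ^ 2 * u ^ 2 / (2 * t ^ 4) = x / 2 / t ^ 4 * (x * u ^ 2) := by field_simp
        _ ≤ x / 2 / s ^ 3 * E := by gcongr
    have h2 : |(u * e) * (x / t ^ 4 + κ / (2 * t ^ 2 * s ^ 2))|
        ≤ (x + |κ|) / (2 * √x) / s ^ 3 * E := by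
      rw [abs_mul]
      have hb : |x / t ^ 4 + κ / (2 * t ^ 2 * s ^ 2)| ≤ (x + |κ|) / s ^ 4 := by
        refine (abs_add_le _ _).trans ?_
        rw [abs_div, abs_div, abs_of_pos hx, abs_of_pos (by positivity : 0 < t ^ 4),
          abs_of_pos (by positivity : 0 < 2 * t ^ 2 * s ^ 2), add_div]
        gcongr
        calc s ^ 4 = s ^ 2 * s ^ 2 := by ring
          _ ≤ t ^ 2 * s ^ 2 := by gcongr
          _ ≤ 2 * t ^ 2 * s ^ 2 := by nlinarith [mul_pos (pow_pos ht0 2) (pow_pos hs0 2)]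
      calc |u * e| * |x / t ^ 4 + κ / (2 * t ^ 2 * s ^ 2)|
          ≤ (s * E / (2 * √x)) * ((x + |κ|) / s ^ 4) := by gcongr
        _ = (x + |κ|) / (2 * √x) / s ^ 3 * E := by field_simp
    have h3 : 0 ≤ e ^ 2 / (2 * t ^ 4 * s ^ 2) := by positivity
    have h4 := (abs_le.1 h2).1
    rw [hid, hK, add_div, add_mul]
    linarith
  exact weighted_le_of_le_damped hs ht hts hK0 hA0 hEA herr

/-- Discrete Grönwall: `∏ (1 + δ k) ≤ exp (∑ δ k)`. -/
lemma exists_bound_of_le_one_add_mul {B δ : ℕ → ℝ} {n₀ : ℕ} (hB : ∀ n, n₀ ≤ n → 0 ≤ B n)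
    (hδ : ∀ n, 0 ≤ δ n) (hsum : Summable δ)
    (h : ∀ n, n₀ ≤ n → B (n + 1) ≤ (1 + δ n) * B n) : ∃ C, ∀ n, n₀ ≤ n → B n ≤ C := by
  refine ⟨Real.exp (∑' n, δ n) * B n₀, fun n hn => ?_⟩
  have key : B n ≤ Real.exp (∑ k ∈ Finset.range n, δ k) * B n₀ := by
    induction n, hn using Nat.le_induction with
    | base =>
      exact le_mul_of_one_le_left (hB _ le_rfl)
        (Real.one_le_exp (Finset.sum_nonneg fun i _ => hδ i))
    | succ n hn ih =>
      rw [Finset.sum_range_succ, Real.exp_add]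
      calc B (n + 1) ≤ (1 + δ n) * B n := h n hn
        _ ≤ Real.exp (δ n) * (Real.exp (∑ k ∈ Finset.range n, δ k) * B n₀) := by
          have := Real.add_one_le_exp (δ n)
          have h0 := hB n hn
          have h1 := hδ n
          gcongr
          linarith
        _ = _ := by ring
  refine key.trans ?_
  have := hB n₀ le_rfl
  gcongr
  exact hsum.sum_le_tsum _ fun i _ => hδ i

lemma oscillator_decay {x : ℝ} (hx : 0 < x) {u e : ℕ → ℝ}
    (he : ∀ n, e (n + 1) = e n - x * u n) (hu : ∀ n : ℕ, ((n : ℝ) + 1) * (u (n + 1) - u n) = e (n + 1)) :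
    ∃ C, 0 ≤ C ∧ ∀ n : ℕ, 1 ≤ n → √n * u n ^ 2 ≤ C ∧ e n ^ 2 ≤ C * √n := by
  set κ := 1 / 2 - x with hκ
  set K := 1 + 4 * (x / 2 + (x + |κ|) / (2 * √x)) with hK
  have hK0 : 0 ≤ K := by positivity
  -- Beyond this threshold `κ² ≤ x n`, so the cross term is at most half of the positive part of the
  -- energy.
  obtain ⟨n₁, hn₁⟩ := exists_nat_ge (κ ^ 2 / x)
  set n₀ := max n₁ 1
  set B : ℕ → ℝ := fun n => √n * (x * u n ^ 2 + e n ^ 2 / n + κ * u n * e n / n) with hB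
  have hbasic : ∀ n, n₀ ≤ n → (x * u n ^ 2 + e n ^ 2 / n) * √n ≤ 2 * B n ∧
      B (n + 1) ≤ (1 + K / √n ^ 3) * B n := by
    intro n hn
    have hn1 : (1 : ℝ) ≤ n := by exact_mod_cast (le_max_right n₁ 1).trans hn
    have hs : 1 ≤ √(n : ℝ) := Real.one_le_sqrt.2 hn1
    have hs2 : √(n : ℝ) ^ 2 = n := Real.sq_sqrt (by positivity)
    have ht2 : √((n + 1 : ℕ) : ℝ) ^ 2 = n + 1 := by
      rw [Real.sq_sqrt (by positivity)]; push_cast; ring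
    have hκn : κ ^ 2 ≤ x * √(n : ℝ) ^ 2 := by
      rw [hs2, mul_comm, ← div_le_iff₀ hx]
      exact hn₁.trans (by exact_mod_cast (le_max_left n₁ 1).trans hn)
    have := oscillator_energy_step (u := u n) (e := e n) (u' := u (n + 1)) hx hs
      (Real.sqrt_nonneg ((n + 1 : ℕ) : ℝ)) (by rw [hs2, ht2]) hκn (he n) (by rw [ht2, hu])
    dsimp only at this
    rw [ht2, hs2] at this
    obtain ⟨h1, h2⟩ := this
    refine ⟨?_, ?_⟩
    · rw [hB]; nlinarith
    · simp only [hB]; push_cast at h2 ⊢; exact h2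
  have hsum : Summable fun n : ℕ => K / √(n : ℝ) ^ 3 := by
    have : Summable fun n : ℕ => 1 / (n : ℝ) ^ (3 / 2 : ℝ) :=
      Real.summable_one_div_nat_rpow.2 (by norm_num)
    refine (this.mul_left K).congr fun n => ?_
    rw [mul_one_div, Real.sqrt_eq_rpow, ← Real.rpow_natCast, ← Real.rpow_mul (by positivity)]
    norm_num
  obtain ⟨C, hC⟩ := exists_bound_of_le_one_add_mul (B := B) (n₀ := n₀)
    (fun n hn => by
      have := (hbasic n hn).1
      have h0 : 0 ≤ (x * u n ^ 2 + e n ^ 2 / n) * √n := by positivity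
      linarith)
    (fun n => by positivity) hsum (fun n hn => (hbasic n hn).2)
  set D : ℕ → ℝ := fun n => (x * u n ^ 2 + e n ^ 2 / n) * √n with hD
  have hD0 : ∀ n, 0 ≤ D n := fun n => by simp only [hD]; positivity
  obtain ⟨M, hM⟩ : ∃ M, ∀ n, D n ≤ M := by
    -- The first summand absorbs the finitely many indices below `n₀`.
    refine ⟨∑ k ∈ Finset.range n₀, D k + 2 * |C|, fun n => ?_⟩
    have hS : 0 ≤ ∑ k ∈ Finset.range n₀, D k := Finset.sum_nonneg fun i _ => hD0 i
    rcases lt_or_ge n n₀ with h | h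
    · have := Finset.single_le_sum (f := D) (fun i _ => hD0 i) (Finset.mem_range.2 h)
      have := abs_nonneg C
      linarith
    · have := (hbasic n h).1
      have := hC n h
      have := le_abs_self C
      simp only [hD]
      linarith
  have hM0 : 0 ≤ M := (hD0 0).trans (hM 0)
  refine ⟨max (M / x) M, le_max_of_le_right hM0, fun n hn => ⟨?_, ?_⟩⟩
  · apply le_max_of_le_left
    rw [le_div_iff₀ hx]
    refine le_trans ?_ (hM n)
    have : 0 ≤ e n ^ 2 / n * √n := by positivity
    simp only [hD]
    linarith
  · have hn0 : (0 : ℝ) < n := by exact_mod_cast hn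
    have h1 : e n ^ 2 / n * √n ≤ M := by
      refine le_trans ?_ (hM n)
      have : 0 ≤ x * u n ^ 2 * √n := by positivity
      simp only [hD]
      linarith
    have hs : 0 < √(n : ℝ) := Real.sqrt_pos.2 hn0
    have hs2 : √(n : ℝ) * √n = n := Real.mul_self_sqrt hn0.le
    have h2 : e n ^ 2 ≤ M * √n := by
      have h3 : e n ^ 2 / n * √n = e n ^ 2 / √n := by
        nth_rw 1 [← hs2]; field_simp
      rwa [h3, div_le_iff₀ hs] at h1
    exact h2.trans (by gcongr; exact le_max_right _ _)

/-- For `k ≤ N²` the sum telescopes to `(e k - e (k+N))/x`, where both indices are `O(N²)` and hence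
both values `O(√N)`. For `k > N²` each of the `N` terms is already `O(N^{-1/2})`. -/
lemma oscillator_sum_bound {x : ℝ} (hx : 0 < x) {u e : ℕ → ℝ} (he0 : e 0 = 0)
    (he : ∀ n, e (n + 1) = e n - x * u n) (hu : ∀ n : ℕ, ((n : ℝ) + 1) * (u (n + 1) - u n) = e (n + 1)) :
    ∃ C, 0 ≤ C ∧ ∀ k N : ℕ, |∑ n ∈ Finset.range N, u (k + n)| ≤ C * √N := by
  obtain ⟨C, hC0, hC⟩ := oscillator_decay hx he hu
  have htel : ∀ k N : ℕ, x * ∑ n ∈ Finset.range N, u (k + n) = e k - e (k + N) := by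
    intro k N
    induction N with
    | zero => simp
    | succ N ih => rw [Finset.sum_range_succ, mul_add, ih, ← add_assoc, he]; ring
  have hesmall : ∀ n N : ℕ, n ≤ 4 * N ^ 2 → |e n| ≤ √(2 * C) * √N := by
    intro n N h
    -- The decay estimate starts at `n = 1`, so index `0` relies on `e 0 = 0`.
    rcases Nat.eq_zero_or_pos n with rfl | hn
    · rw [he0, abs_zero]; positivity
    · rw [← Real.sqrt_mul (by positivity)]
      apply Real.abs_le_sqrt
      have h1 : √(n : ℝ) ≤ 2 * N := by
        rw [Real.sqrt_le_left (by positivity)]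
        calc (n : ℝ) ≤ (4 * N ^ 2 : ℕ) := by exact_mod_cast h
          _ = (2 * N) ^ 2 := by push_cast; ring
      calc e n ^ 2 ≤ C * √n := (hC n hn).2
        _ ≤ C * (2 * N) := by gcongr
        _ = 2 * C * N := by ring
  refine ⟨max (2 * √(2 * C) / x) (√C), le_max_of_le_right (by positivity), fun k N => ?_⟩
  rcases Nat.eq_zero_or_pos N with rfl | hN
  · simp
  have hN0 : (0 : ℝ) < N := by exact_mod_cast hN
  rcases le_or_gt k (N ^ 2) with h | h
  · have h1 := hesmall k N (by nlinarith)
    have h2 := hesmall (k + N) N (by nlinarith)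
    have h3 : ∑ n ∈ Finset.range N, u (k + n) = (e k - e (k + N)) / x := by
      rw [← htel]; field_simp
    calc |∑ n ∈ Finset.range N, u (k + n)| = |e k - e (k + N)| / x := by
          rw [h3, abs_div, abs_of_pos hx]
      _ ≤ (√(2 * C) * √N + √(2 * C) * √N) / x := by
          gcongr
          exact (abs_sub _ _).trans (add_le_add h1 h2)
      _ = 2 * √(2 * C) / x * √N := by ring
      _ ≤ _ := by gcongr; exact le_max_left _ _
  · have h1 : ∀ n, |u (k + n)| ≤ √(C / N) := by
      intro n
      apply Real.abs_le_sqrt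
      have hk : 1 ≤ k + n := by omega
      have h2 : (N : ℝ) ≤ √((k + n : ℕ) : ℝ) := by
        apply Real.le_sqrt_of_sq_le
        exact_mod_cast h.le.trans (Nat.le_add_right _ _)
      rw [le_div_iff₀ hN0]
      calc u (k + n) ^ 2 * N ≤ u (k + n) ^ 2 * √((k + n : ℕ) : ℝ) := by gcongr
        _ ≤ C := by rw [mul_comm]; exact (hC _ hk).1
    calc |∑ n ∈ Finset.range N, u (k + n)| ≤ ∑ n ∈ Finset.range N, |u (k + n)| :=
          Finset.abs_sum_le_sum_abs _ _
      _ ≤ ∑ n ∈ Finset.range N, √(C / N) := Finset.sum_le_sum fun n _ => h1 n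
      _ = √C * √N := by
          rw [Finset.sum_const, Finset.card_range, nsmul_eq_mul, Real.sqrt_div hC0]
          have hs : 0 < √(N : ℝ) := Real.sqrt_pos.2 hN0
          have hs2 : √(N : ℝ) * √N = N := Real.mul_self_sqrt hN0.le
          nth_rw 1 [← hs2]
          field_simp
      _ ≤ _ := by gcongr; exact le_max_right _ _

/-! ### Laguerre recurrences and window sums -/

/-- The antiderivative of `laguerreL n` vanishing at `0`. -/
noncomputable def laguerrePrimitive (n : ℕ) (x : ℝ) : ℝ :=
  ∑ k ∈ Finset.range (n + 1),
    (n.choose k : ℝ) * ((-1) ^ k / ((k + 1).factorial : ℝ)) * x ^ (k + 1)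

lemma laguerreL_zero (x : ℝ) : laguerreL 0 x = 1 := by simp [laguerreL]

/-- Pascal's rule, coefficient by coefficient. This is the source of `T L_n = L_{n+1}`. -/
lemma laguerreL_succ (n : ℕ) (x : ℝ) :
    laguerreL (n + 1) x = laguerreL n x - laguerrePrimitive n x := by
  have h1 : laguerreL n x = ∑ k ∈ Finset.range (n + 1 + 1),
      (n.choose k : ℝ) * ((-1) ^ k / (k.factorial : ℝ)) * x ^ k := by
    rw [Finset.sum_range_succ]; simp [laguerreL]
  rw [h1, laguerreL, laguerrePrimitive, Finset.sum_range_succ', Finset.sum_range_succ' _ (n + 1),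
    add_sub_right_comm, ← Finset.sum_sub_distrib]
  congr 1
  · refine Finset.sum_congr rfl fun k _ => ?_
    rw [Nat.choose_succ_succ]
    push_cast
    rw [pow_succ (-1 : ℝ)]
    ring
  · simp

lemma laguerreL_apply_zero (n : ℕ) : laguerreL n 0 = 1 := by
  induction n with
  | zero => exact laguerreL_zero 0
  | succ n ih => rw [laguerreL_succ, ih]; simp [laguerrePrimitive]

lemma continuous_laguerreL (n : ℕ) : Continuous (laguerreL n) := by
  unfold laguerreL; fun_prop

lemma hasDerivAt_laguerrePrimitive (n : ℕ) (x : ℝ) :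
    HasDerivAt (laguerrePrimitive n) (laguerreL n x) x := by
  unfold laguerrePrimitive laguerreL
  refine HasDerivAt.fun_sum fun k _ => ?_
  have := (hasDerivAt_pow (k + 1) x).const_mul
    ((n.choose k : ℝ) * ((-1) ^ k / ((k + 1).factorial : ℝ)))
  convert! this using 1
  rw [Nat.factorial_succ]
  push_cast
  have : (k.factorial : ℝ) ≠ 0 := by positivity
  field_simp

lemma integral_laguerreL (n : ℕ) (x : ℝ) :
    ∫ y in (0 : ℝ)..x, laguerreL n y = laguerrePrimitive n x := by
  rw [intervalIntegral.integral_eq_sub_of_hasDerivAt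
    (fun y _ => hasDerivAt_laguerrePrimitive n y)
    ((continuous_laguerreL n).intervalIntegrable _ _)]
  simp [laguerrePrimitive]

/-- The sums of Laguerre polynomials along a window of length `N` are `O(√N)` at each `x > 0`,
uniformly in the position of the window. -/
lemma laguerreL_sum_bound {x : ℝ} (hx : 0 < x) :
    ∃ C, 0 ≤ C ∧ ∀ k N : ℕ, |∑ n ∈ Finset.range N, laguerreL (k + n) x| ≤ C * √N := by
  -- This is `x L_n'(x)`, which equals `n (L_n(x) - L_{n-1}(x))` for `n ≥ 1`.
  set e : ℕ → ℝ := fun n => ∑ k ∈ Finset.range n,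
    (n.choose (k + 1) : ℝ) * ((-1) ^ (k + 1) / (k.factorial : ℝ)) * x ^ (k + 1) with he
  refine oscillator_sum_bound (e := e) (u := fun n => laguerreL n x) hx (by simp [he]) ?_ ?_
  · intro n
    have h1 : e n = ∑ k ∈ Finset.range (n + 1),
        (n.choose (k + 1) : ℝ) * ((-1) ^ (k + 1) / (k.factorial : ℝ)) * x ^ (k + 1) := by
      rw [Finset.sum_range_succ]; simp [he]
    rw [h1]
    simp only [he, laguerreL]
    rw [Finset.mul_sum, ← Finset.sum_sub_distrib]
    refine Finset.sum_congr rfl fun k _ => ?_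
    rw [Nat.choose_succ_succ]
    push_cast
    ring
  · intro n
    simp only [he, laguerreL_succ, laguerrePrimitive]
    rw [sub_sub_cancel_left, mul_neg, Finset.mul_sum, ← Finset.sum_neg_distrib]
    refine Finset.sum_congr rfl fun k _ => ?_
    have h2 : ((n + 1 : ℕ) : ℝ) * n.choose k = (n + 1).choose (k + 1) * (k + 1 : ℕ) := by
      exact_mod_cast Nat.add_one_mul_choose_eq n k
    rw [Nat.factorial_succ]
    push_cast at h2 ⊢
    have h3 : (k.factorial : ℝ) ≠ 0 := by positivity
    have h4 : (k + 1 : ℝ) ≠ 0 := by positivity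
    field_simp
    rw [pow_succ (-1 : ℝ)]
    linear_combination (-(-1 : ℝ) ^ k) * h2

/-! ### The measure `e^{-x} dx` and orthonormality -/

section

instance isProbabilityMeasure_laguerreMeasure : IsProbabilityMeasure laguerreMeasure := by
  constructor
  rw [laguerreMeasure, withDensity_apply _ MeasurableSet.univ, Measure.restrict_univ,
    ← ofReal_integral_eq_lintegral_ofReal (integrableOn_exp_neg_Ioi 0)
      (ae_of_all _ fun x => (Real.exp_pos _).le), integral_exp_neg_Ioi_zero]
  simp

lemma laguerreMeasure_absolutelyContinuous :
    laguerreMeasure ≪ volume.restrict (Set.Ioi (0 : ℝ)) :=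
  withDensity_absolutelyContinuous _ _

lemma absolutelyContinuous_laguerreMeasure :
    volume.restrict (Set.Ioi (0 : ℝ)) ≪ laguerreMeasure :=
  withDensity_absolutelyContinuous' (by fun_prop) (ae_of_all _ fun x => by simp [Real.exp_pos])

lemma ae_laguerreMeasure_pos : ∀ᵐ x ∂laguerreMeasure, 0 < x :=
  laguerreMeasure_absolutelyContinuous.ae_le (ae_restrict_mem measurableSet_Ioi)

lemma integral_laguerreMeasure {E : Type*} [NormedAddCommGroup E] [NormedSpace ℝ E] (g : ℝ → E) :
    ∫ x, g x ∂laguerreMeasure = ∫ x in Set.Ioi (0 : ℝ), Real.exp (-x) • g x := by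
  rw [laguerreMeasure, integral_withDensity_eq_integral_toReal_smul (by fun_prop) (by simp)]
  simp [ENNReal.toReal_ofReal (Real.exp_pos _).le]

lemma integrable_laguerreMeasure_iff {E : Type*} [NormedAddCommGroup E] [NormedSpace ℝ E]
    {g : ℝ → E} : Integrable g laguerreMeasure ↔
      IntegrableOn (fun x => Real.exp (-x) • g x) (Set.Ioi (0 : ℝ)) := by
  rw [laguerreMeasure, integrable_withDensity_iff_integrable_smul' (by fun_prop) (by simp)]
  simp [ENNReal.toReal_ofReal (Real.exp_pos _).le, IntegrableOn]

lemma integrable_pow_laguerreMeasure (n : ℕ) : Integrable (fun x => x ^ n) laguerreMeasure := by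
  rw [integrable_laguerreMeasure_iff]
  have := Real.GammaIntegral_convergent (s := n + 1) (by positivity)
  refine this.congr_fun (fun x _ => ?_) measurableSet_Ioi
  simp

lemma integral_pow_laguerreMeasure (n : ℕ) :
    ∫ x, x ^ n ∂laguerreMeasure = n.factorial := by
  rw [integral_laguerreMeasure, ← Real.Gamma_nat_eq_factorial,
    Real.Gamma_eq_integral (by positivity)]
  refine setIntegral_congr_fun measurableSet_Ioi fun x _ => ?_
  simp

lemma integrable_polynomial_laguerreMeasure (p : Polynomial ℝ) :
    Integrable (fun x => p.eval x) laguerreMeasure := by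
  induction p using Polynomial.induction_on' with
  | add p q hp hq => simp only [Polynomial.eval_add]; exact hp.add hq
  | monomial n a => simpa using (integrable_pow_laguerreMeasure n).const_mul a

/-- Integration by parts against `e^{-x}`, checked on monomials through the moments `n!`. -/
lemma integral_derivative_laguerreMeasure (p : Polynomial ℝ) :
    ∫ x, p.derivative.eval x ∂laguerreMeasure =
      ∫ x, p.eval x ∂laguerreMeasure - p.eval 0 := by
  induction p using Polynomial.induction_on' with
  | add p q hp hq =>
    simp only [Polynomial.derivative_add, Polynomial.eval_add]
    rw [integral_add (integrable_polynomial_laguerreMeasure _)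
      (integrable_polynomial_laguerreMeasure _), integral_add
      (integrable_polynomial_laguerreMeasure _) (integrable_polynomial_laguerreMeasure _), hp, hq]
    ring
  | monomial n a =>
    cases n with
    | zero => simp
    | succ n =>
      simp only [Polynomial.derivative_monomial, Polynomial.eval_monomial, integral_const_mul,
        integral_pow_laguerreMeasure, Nat.add_sub_cancel, Nat.factorial_succ]
      push_cast
      simp
      ring

/-- `laguerreL` as a polynomial. -/
noncomputable def laguerrePoly (n : ℕ) : Polynomial ℝ :=
  ∑ k ∈ Finset.range (n + 1),
    Polynomial.C ((n.choose k : ℝ) * ((-1) ^ k / (k.factorial : ℝ))) * Polynomial.X ^ k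

lemma eval_laguerrePoly (n : ℕ) (x : ℝ) : (laguerrePoly n).eval x = laguerreL n x := by
  simp [laguerrePoly, laguerreL, Polynomial.eval_finsetSum]

lemma derivative_laguerrePoly_sub (n : ℕ) :
    (laguerrePoly n - laguerrePoly (n + 1)).derivative = laguerrePoly n := by
  apply Polynomial.funext fun x => ?_
  have h := (laguerrePoly n - laguerrePoly (n + 1)).hasDerivAt x
  have h2 : HasDerivAt (fun y => (laguerrePoly n - laguerrePoly (n + 1)).eval y)
      (laguerreL n x) x := by
    convert hasDerivAt_laguerrePrimitive n x using 1
    funext y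
    simp [eval_laguerrePoly, laguerreL_succ]
  rw [eval_laguerrePoly, h.unique h2]

lemma integral_laguerrePoly_mul (n m : ℕ) :
    ∫ x, (laguerrePoly n * laguerrePoly m).eval x ∂laguerreMeasure = if n = m then 1 else 0 := by
  have key : ∀ n m, ∫ x, (laguerrePoly (n + 1) * laguerrePoly (m + 1)).eval x ∂laguerreMeasure =
      ∫ x, (laguerrePoly n * laguerrePoly m).eval x ∂laguerreMeasure := by
    intro n m
    set P := laguerrePoly n - laguerrePoly (n + 1) with hP
    set Q := laguerrePoly m - laguerrePoly (m + 1) with hQ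
    -- Since `P' = L_n` and `L_{n+1} = P' - P`, the product is `(P' - P)(Q' - Q)`. As `P Q` vanishes
    -- at `0`, the integrals of `P Q` and `(P Q)'` cancel, so raising both indices preserves the
    -- inner product.
    have h1 : laguerrePoly (n + 1) * laguerrePoly (m + 1) =
        laguerrePoly n * laguerrePoly m + P * Q - (P * Q).derivative := by
      rw [Polynomial.derivative_mul, hP, hQ, derivative_laguerrePoly_sub,
        derivative_laguerrePoly_sub]
      ring
    have h2 : (P * Q).eval 0 = 0 := by
      simp [hP, eval_laguerrePoly, laguerreL_apply_zero]
    rw [h1]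
    simp only [Polynomial.eval_sub, Polynomial.eval_add]
    rw [integral_sub, integral_add, integral_derivative_laguerreMeasure, h2]
    · ring
    · exact integrable_polynomial_laguerreMeasure _
    · exact integrable_polynomial_laguerreMeasure _
    · exact (integrable_polynomial_laguerreMeasure _).add (integrable_polynomial_laguerreMeasure _)
    · exact integrable_polynomial_laguerreMeasure _
  have h0 : laguerrePoly 0 = 1 := Polynomial.funext fun x => by
    simp [eval_laguerrePoly, laguerreL_zero]
  have hz : ∀ m, ∫ x, (laguerrePoly (m + 1)).eval x ∂laguerreMeasure = 0 := by
    intro m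
    set Q := laguerrePoly m - laguerrePoly (m + 1) with hQ
    have h1 : laguerrePoly (m + 1) = Q.derivative - Q := by
      rw [hQ, derivative_laguerrePoly_sub]; ring
    rw [h1]
    simp only [Polynomial.eval_sub]
    rw [integral_sub (integrable_polynomial_laguerreMeasure _)
      (integrable_polynomial_laguerreMeasure _), integral_derivative_laguerreMeasure]
    simp [hQ, eval_laguerrePoly, laguerreL_apply_zero]
  induction n generalizing m with
  | zero =>
    cases m with
    | zero => simp [h0]
    | succ m => simpa [h0] using hz m
  | succ n ih =>
    cases m with
    | zero => simpa [h0] using hz n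
    | succ m => rw [key, ih]; simp

lemma integral_laguerreL_mul (n m : ℕ) :
    ∫ x, laguerreL n x * laguerreL m x ∂laguerreMeasure = if n = m then 1 else 0 := by
  rw [← integral_laguerrePoly_mul]
  simp [eval_laguerrePoly]

variable {𝕜 : Type*} [RCLike 𝕜]

lemma memLp_polynomial_laguerreMeasure (p : Polynomial ℝ) :
    MemLp (fun x => ((p.eval x : ℝ) : 𝕜)) 2 laguerreMeasure := by
  have h : MemLp (fun x => p.eval x) 2 laguerreMeasure := by
    rw [memLp_two_iff_integrable_sq p.continuous.aestronglyMeasurable]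
    have := integrable_polynomial_laguerreMeasure (p ^ 2)
    simp only [Polynomial.eval_pow] at this
    exact this
  exact h.ofReal

lemma memLp_laguerreL (n : ℕ) :
    MemLp (fun x => ((laguerreL n x : ℝ) : 𝕜)) 2 laguerreMeasure := by
  simpa only [eval_laguerrePoly] using memLp_polynomial_laguerreMeasure (𝕜 := 𝕜) (laguerrePoly n)

lemma memLp_exp_laguerreMeasure {t : ℝ} (ht : t < 1 / 2) :
    MemLp (fun x => Real.exp (t * x)) 2 laguerreMeasure := by
  rw [memLp_two_iff_integrable_sq (by fun_prop), integrable_laguerreMeasure_iff]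
  have := integrableOn_exp_mul_Ioi (a := 2 * t - 1) (by linarith) 0
  refine this.congr_fun (fun x _ => ?_) measurableSet_Ioi
  simp only [smul_eq_mul]
  rw [← Real.exp_nat_mul, ← Real.exp_add]
  congr 1
  push_cast
  ring

end

/-! ### Completeness via determinacy of moments -/

section

open ProbabilityTheory in
/-- Finite measures whose moment generating functions are finite near `0` are determined by their
moments. -/
lemma ext_of_moments_eq {μ ν : Measure ℝ} [IsFiniteMeasure μ] [IsFiniteMeasure ν]
    (hμ : 0 ∈ interior (integrableExpSet id μ)) (hν : 0 ∈ interior (integrableExpSet id ν))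
    (h : ∀ n : ℕ, ∫ x, x ^ n ∂μ = ∫ x, x ^ n ∂ν) : μ = ν := by
  set U := {z : ℂ | z.re ∈ interior (integrableExpSet id μ) ∩ interior (integrableExpSet id ν)}
    with hU
  have hμU : AnalyticOnNhd ℂ (complexMGF id μ) U :=
    analyticOnNhd_complexMGF.mono fun z hz => hz.1
  have hνU : AnalyticOnNhd ℂ (complexMGF id ν) U :=
    analyticOnNhd_complexMGF.mono fun z hz => hz.2
  have h0 : (0 : ℂ) ∈ U := by simp [hU, hμ, hν]
  have hconn : IsPreconnected U :=
    ((convex_integrableExpSet.interior.inter convex_integrableExpSet.interior).linear_preimage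
      Complex.reLm).isPreconnected
  -- The derivatives of the complex moment generating functions at `0` are the moments. The identity
  -- theorem carries equality from there to the vertical strip `U`, which contains the imaginary
  -- axis.
  have hd : ∀ n, iteratedDeriv n (complexMGF id μ) 0 = iteratedDeriv n (complexMGF id ν) 0 := by
    intro n
    rw [iteratedDeriv_complexMGF (by simpa using hμ), iteratedDeriv_complexMGF (by simpa using hν)]
    simp only [id, zero_mul, Complex.exp_zero, mul_one, ← Complex.ofReal_pow]
    rw [integral_complex_ofReal, integral_complex_ofReal, h]
  have hev : complexMGF id μ =ᶠ[𝓝 0] complexMGF id ν := by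
    have p1 := (hμU 0 h0).hasFPowerSeriesAt
    have p2 := (hνU 0 h0).hasFPowerSeriesAt
    simp only [hd] at p1
    have p3 := p1.sub p2
    rw [sub_self] at p3
    filter_upwards [p3.eventually_eq_zero] with z hz using sub_eq_zero.1 hz
  have heq : Set.EqOn (complexMGF id μ) (complexMGF id ν) U :=
    hμU.eqOn_of_preconnected_of_eventuallyEq hνU hconn h0 hev
  refine Measure.ext_of_charFun ?_
  ext t
  have := heq (x := t * Complex.I) (by simp [hU, hμ, hν])
  rwa [complexMGF_id_mul_I, complexMGF_id_mul_I] at this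

open ProbabilityTheory in
lemma ae_eq_zero_of_moments_eq_zero_real {g : ℝ → ℝ} (hg : MemLp g 2 laguerreMeasure)
    (h : ∀ n : ℕ, ∫ x, g x * x ^ n ∂laguerreMeasure = 0) : g =ᵐ[laguerreMeasure] 0 := by
  -- `ENNReal.ofReal` truncates at `0`, so these densities are the positive part of `g` and, applied
  -- to `-g`, the negative part. Equal moments make the two measures equal.
  have key : ∀ g : ℝ → ℝ, MemLp g 2 laguerreMeasure →
      IsFiniteMeasure (laguerreMeasure.withDensity fun x => ENNReal.ofReal (g x)) ∧
      0 ∈ interior (integrableExpSet id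
        (laguerreMeasure.withDensity fun x => ENNReal.ofReal (g x))) ∧
      ∀ n : ℕ, ∫ x, x ^ n ∂(laguerreMeasure.withDensity fun x => ENNReal.ofReal (g x)) =
        ∫ x, max (g x) 0 * x ^ n ∂laguerreMeasure := by
    intro g hg
    have hm : AEMeasurable (fun x => ENNReal.ofReal (g x)) laguerreMeasure :=
      hg.1.aemeasurable.ennreal_ofReal
    refine ⟨isFiniteMeasure_withDensity_ofReal (hg.integrable (by norm_num)).2, ?_, ?_⟩
    · rw [mem_interior_iff_mem_nhds]
      filter_upwards [Iio_mem_nhds (by norm_num : (0 : ℝ) < 1 / 2)] with t ht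
      simp only [integrableExpSet, Set.mem_ofPred_eq, id]
      rw [integrable_withDensity_iff_integrable_smul₀' hm (by simp)]
      have h1 : Integrable (fun x => g x * Real.exp (t * x)) laguerreMeasure :=
        hg.integrable_mul (memLp_exp_laguerreMeasure ht)
      refine h1.mono ?_ ?_
      · exact (hm.ennreal_toReal.aestronglyMeasurable).smul (by fun_prop)
      · refine ae_of_all _ fun x => ?_
        rw [smul_eq_mul, norm_mul, norm_mul]
        gcongr
        rw [ENNReal.toReal_ofReal', Real.norm_eq_abs, Real.norm_eq_abs]
        exact abs_max_le_max_abs_abs.trans (by simp)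
    · intro n
      rw [integral_withDensity_eq_integral_toReal_smul₀ hm (by simp)]
      simp [ENNReal.toReal_ofReal']
  have hg' : MemLp (fun x => -g x) 2 laguerreMeasure := hg.neg
  obtain ⟨hf1, hi1, hm1⟩ := key g hg
  obtain ⟨hf2, hi2, hm2⟩ := key (fun x => -g x) hg'
  have hint : ∀ g : ℝ → ℝ, MemLp g 2 laguerreMeasure → ∀ n : ℕ,
      Integrable (fun x => max (g x) 0 * x ^ n) laguerreMeasure := by
    intro g hg n
    have hp : MemLp (fun x : ℝ => x ^ n) 2 laguerreMeasure := by
      simpa using memLp_polynomial_laguerreMeasure (𝕜 := ℝ) (Polynomial.X ^ n)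
    exact hg.pos_part.integrable_mul hp
  have heq := ext_of_moments_eq hi1 hi2 fun n => by
    rw [hm1, hm2, ← sub_eq_zero, ← integral_sub (hint g hg n) (hint _ hg' n)]
    refine (integral_congr_ae (ae_of_all _ fun x => ?_)).trans (h n)
    change max (g x) 0 * x ^ n - max (-g x) 0 * x ^ n = g x * x ^ n
    rw [← sub_mul, max_zero_sub_max_neg_zero_eq_self]
  have hm := hg.1.aemeasurable
  rw [withDensity_eq_iff hm.ennreal_ofReal hg'.1.aemeasurable.ennreal_ofReal] at heq
  · filter_upwards [heq] with x hx
    have := congrArg ENNReal.toReal hx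
    rw [ENNReal.toReal_ofReal', ENNReal.toReal_ofReal'] at this
    rcases le_total (g x) 0 with h | h <;> simp [h] at this <;> simp [this]
  · have := hf1.measure_univ_lt_top
    rw [withDensity_apply _ MeasurableSet.univ, Measure.restrict_univ] at this
    exact this.ne

variable {𝕜 : Type*} [RCLike 𝕜]

lemma ae_eq_zero_of_moments_eq_zero {g : ℝ → 𝕜} (hg : MemLp g 2 laguerreMeasure)
    (h : ∀ n : ℕ, ∫ x, g x * ((x ^ n : ℝ) : 𝕜) ∂laguerreMeasure = 0) :
    g =ᵐ[laguerreMeasure] 0 := by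
  have hint : ∀ n : ℕ, Integrable (fun x => g x * ((x ^ n : ℝ) : 𝕜)) laguerreMeasure := fun n =>
    hg.integrable_mul (by
      simpa using memLp_polynomial_laguerreMeasure (𝕜 := 𝕜) (Polynomial.X ^ n))
  have hre := ae_eq_zero_of_moments_eq_zero_real hg.re fun n => by
    have := integral_re (hint n)
    rw [h n, map_zero] at this
    rw [← this]
    exact integral_congr_ae (ae_of_all _ fun x => (RCLike.re_mul_ofReal _ _).symm)
  have him := ae_eq_zero_of_moments_eq_zero_real hg.im fun n => by
    have := integral_im (hint n)
    rw [h n, map_zero] at this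
    rw [← this]
    exact integral_congr_ae (ae_of_all _ fun x => (RCLike.im_mul_ofReal _ _).symm)
  filter_upwards [hre, him] with x h1 h2
  exact RCLike.ext (by simpa using h1) (by simpa using h2)

/-- The Laguerre polynomials are complete in `L²`. -/
lemma ae_eq_zero_of_laguerreCoeff_eq_zero {g : ℝ → 𝕜} (hg : MemLp g 2 laguerreMeasure)
    (h : ∀ n : ℕ, laguerreCoeff g n = 0) : g =ᵐ[laguerreMeasure] 0 := by
  have hint : ∀ n : ℕ, Integrable (fun x => g x * ((x ^ n : ℝ) : 𝕜)) laguerreMeasure := fun n =>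
    hg.integrable_mul (by
      simpa using memLp_polynomial_laguerreMeasure (𝕜 := 𝕜) (Polynomial.X ^ n))
  refine ae_eq_zero_of_moments_eq_zero hg fun n => ?_
  induction n using Nat.strong_induction_on with
  | _ n ih =>
    have h1 := h n
    have h2 : laguerreCoeff g n = ∑ k ∈ Finset.range (n + 1),
        (((n.choose k : ℝ) * ((-1) ^ k / (k.factorial : ℝ)) : ℝ) : 𝕜) *
          ∫ x, g x * ((x ^ k : ℝ) : 𝕜) ∂laguerreMeasure := by
      simp_rw [← integral_const_mul]
      rw [← integral_finsetSum _ fun k _ => (hint k).const_mul _]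
      refine integral_congr_ae (ae_of_all _ fun x => ?_)
      simp only [laguerreL]
      push_cast
      rw [Finset.mul_sum]
      exact Finset.sum_congr rfl fun k _ => by ring
    rw [h1, Finset.sum_range_succ, Finset.sum_eq_zero, zero_add] at h2
    -- The system is triangular with nonzero leading coefficients, so vanishing Laguerre
    -- coefficients force vanishing moments.
    · have h3 : (((n.choose n : ℝ) * ((-1) ^ n / (n.factorial : ℝ)) : ℝ) : 𝕜) ≠ 0 := by
        rw [RCLike.ofReal_ne_zero]
        simp [Nat.factorial_ne_zero]
      exact (mul_eq_zero.1 h2.symm).resolve_left h3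
    · intro k hk
      rw [ih k (Finset.mem_range.1 hk), mul_zero]

end

/-! ### The shift and its identification with `T` -/

section

open scoped InnerProductSpace

variable {𝕜 : Type*} [RCLike 𝕜]

/-- The `n`-th Laguerre polynomial as an element of `L²`. -/
noncomputable def laguerreLp (𝕜 : Type*) [RCLike 𝕜] (n : ℕ) : Lp 𝕜 2 laguerreMeasure :=
  (memLp_laguerreL n).toLp _

lemma coeFn_laguerreLp (n : ℕ) :
    laguerreLp 𝕜 n =ᵐ[laguerreMeasure] fun x => (laguerreL n x : 𝕜) :=
  MemLp.coeFn_toLp _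

lemma inner_laguerreLp (n : ℕ) (f : Lp 𝕜 2 laguerreMeasure) :
    ⟪laguerreLp 𝕜 n, f⟫_𝕜 = laguerreCoeff f n := by
  rw [L2.inner_def, laguerreCoeff]
  refine integral_congr_ae ?_
  filter_upwards [coeFn_laguerreLp (𝕜 := 𝕜) n] with x hx
  rw [hx, RCLike.inner_apply, RCLike.conj_ofReal]

lemma orthonormal_laguerreLp : Orthonormal 𝕜 (laguerreLp 𝕜) := by
  classical
  rw [orthonormal_iff_ite]
  intro n m
  rw [inner_laguerreLp, laguerreCoeff]
  have : ∫ x, laguerreLp 𝕜 m x * (laguerreL n x : 𝕜) ∂laguerreMeasure =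
      ∫ x, ((laguerreL n x * laguerreL m x : ℝ) : 𝕜) ∂laguerreMeasure := by
    refine integral_congr_ae ?_
    filter_upwards [coeFn_laguerreLp (𝕜 := 𝕜) m] with x hx
    rw [hx]; push_cast; ring
  rw [this, integral_ofReal, integral_laguerreL_mul]
  split_ifs <;> simp

/-- The Laguerre polynomials as a Hilbert basis. -/
noncomputable def laguerreBasis (𝕜 : Type*) [RCLike 𝕜] :
    HilbertBasis ℕ 𝕜 (Lp 𝕜 2 laguerreMeasure) :=
  HilbertBasis.mkOfOrthogonalEqBot orthonormal_laguerreLp <| by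
    rw [Submodule.eq_bot_iff]
    intro f hf
    rw [Lp.eq_zero_iff_ae_eq_zero]
    refine ae_eq_zero_of_laguerreCoeff_eq_zero (Lp.memLp f) fun n => ?_
    rw [← inner_laguerreLp]
    exact hf _ (Submodule.subset_span ⟨n, rfl⟩)

lemma laguerreBasis_apply (n : ℕ) : laguerreBasis 𝕜 n = laguerreLp 𝕜 n := by
  simp [laguerreBasis]

lemma laguerreBasis_repr_apply (f : Lp 𝕜 2 laguerreMeasure) (n : ℕ) :
    (laguerreBasis 𝕜).repr f n = laguerreCoeff f n := by
  rw [HilbertBasis.repr_apply_apply, laguerreBasis_apply, inner_laguerreLp]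

/-- The unilateral shift on the Laguerre basis. -/
noncomputable def laguerreShift (𝕜 : Type*) [RCLike 𝕜] :
    Lp 𝕜 2 laguerreMeasure →ₗᵢ[𝕜] Lp 𝕜 2 laguerreMeasure :=
  ((orthonormal_laguerreLp (𝕜 := 𝕜)).comp (· + 1)
    (add_left_injective 1)).orthogonalFamily.linearIsometry.comp
    (laguerreBasis 𝕜).repr.toLinearIsometry

lemma laguerreShift_laguerreLp (n : ℕ) :
    laguerreShift 𝕜 (laguerreLp 𝕜 n) = laguerreLp 𝕜 (n + 1) := by
  classical
  rw [laguerreShift, LinearIsometry.coe_comp, Function.comp_apply, LinearIsometryEquiv.coe_toLinearIsometry,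
    ← laguerreBasis_apply, HilbertBasis.repr_self, OrthogonalFamily.linearIsometry_apply_single]
  simp

lemma ae_restrict_Ioc_of_ae_laguerreMeasure {p : ℝ → Prop} (h : ∀ᵐ y ∂laguerreMeasure, p y)
    (x : ℝ) : ∀ᵐ y ∂volume.restrict (Set.Ioc 0 x), p y :=
  ae_mono (Measure.restrict_mono Set.Ioc_subset_Ioi_self le_rfl)
    (absolutelyContinuous_laguerreMeasure.ae_le h)

lemma intervalIntegral_congr_ae_laguerreMeasure {f g : ℝ → 𝕜} (h : f =ᵐ[laguerreMeasure] g)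
    {x : ℝ} (hx : 0 ≤ x) : ∫ y in (0 : ℝ)..x, f y = ∫ y in (0 : ℝ)..x, g y := by
  rw [intervalIntegral.integral_of_le hx, intervalIntegral.integral_of_le hx]
  exact integral_congr_ae (ae_restrict_Ioc_of_ae_laguerreMeasure h x)

lemma laguerreT_congr_ae {f g : ℝ → 𝕜} (h : f =ᵐ[laguerreMeasure] g) :
    laguerreT f =ᵐ[laguerreMeasure] laguerreT g := by
  filter_upwards [h, ae_laguerreMeasure_pos] with x hx hpos
  rw [laguerreT, laguerreT, hx, intervalIntegral_congr_ae_laguerreMeasure h hpos.le]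

/-- The weight representing `f ↦ ∫ y in 0..x, f y` as an inner product in `L²`. -/
noncomputable def primitiveWeight (x : ℝ) : ℝ → ℝ :=
  Set.indicator (Set.Ioc 0 x) Real.exp

lemma memLp_primitiveWeight (x : ℝ) :
    MemLp (fun y => ((primitiveWeight x y : ℝ) : 𝕜)) 2 laguerreMeasure := by
  have : MemLp (primitiveWeight x) 2 laguerreMeasure := by
    refine MemLp.of_bound
      ((Real.measurable_exp.indicator measurableSet_Ioc).aestronglyMeasurable) (Real.exp x)
      (ae_of_all _ fun y => ?_)
    rw [primitiveWeight]
    by_cases hy : y ∈ Set.Ioc 0 x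
    · rw [Set.indicator_of_mem hy, Real.norm_of_nonneg (Real.exp_pos _).le]
      exact Real.exp_le_exp.2 hy.2
    · rw [Set.indicator_of_notMem hy, norm_zero]
      exact (Real.exp_pos _).le
  exact this.ofReal

lemma exp_neg_smul_primitiveWeight (f : ℝ → 𝕜) (x y : ℝ) :
    Real.exp (-y) • (f y * ((primitiveWeight x y : ℝ) : 𝕜)) = (Set.Ioc 0 x).indicator f y := by
  rw [primitiveWeight]
  by_cases hy : y ∈ Set.Ioc 0 x
  · rw [Set.indicator_of_mem hy, Set.indicator_of_mem hy, RCLike.real_smul_eq_coe_mul,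
      mul_left_comm, ← RCLike.ofReal_mul, ← Real.exp_add]
    simp
  · simp [Set.indicator_of_notMem hy]

lemma integral_mul_primitiveWeight (f : ℝ → 𝕜) {x : ℝ} (hx : 0 ≤ x) :
    ∫ y, f y * ((primitiveWeight x y : ℝ) : 𝕜) ∂laguerreMeasure = ∫ y in (0 : ℝ)..x, f y := by
  rw [integral_laguerreMeasure, intervalIntegral.integral_of_le hx]
  simp_rw [exp_neg_smul_primitiveWeight]
  rw [setIntegral_indicator measurableSet_Ioc,
    Set.inter_eq_self_of_subset_right Set.Ioc_subset_Ioi_self]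

lemma intervalIntegrable_of_memLp_laguerreMeasure {f : ℝ → 𝕜} (hf : MemLp f 2 laguerreMeasure)
    {x : ℝ} (hx : 0 ≤ x) : IntervalIntegrable f volume 0 x := by
  rw [intervalIntegrable_iff_integrableOn_Ioc_of_le hx]
  have h1 := hf.integrable_mul (memLp_primitiveWeight (𝕜 := 𝕜) x)
  rw [integrable_laguerreMeasure_iff] at h1
  have h2 : IntegrableOn ((Set.Ioc 0 x).indicator f) (Set.Ioi 0) :=
    h1.congr_fun (fun y _ => exp_neg_smul_primitiveWeight f x y) measurableSet_Ioi
  rw [IntegrableOn, integrable_indicator_iff measurableSet_Ioc, IntegrableOn,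
    Measure.restrict_restrict measurableSet_Ioc,
    Set.inter_eq_self_of_subset_left Set.Ioc_subset_Ioi_self] at h2
  exact h2

/-- For fixed `x` the primitive is thus a continuous functional on `L²`, so it passes to `L²` limits
at every `x`. -/
lemma inner_primitiveWeight (f : Lp 𝕜 2 laguerreMeasure) {x : ℝ} (hx : 0 ≤ x) :
    ⟪(memLp_primitiveWeight (𝕜 := 𝕜) x).toLp _, f⟫_𝕜 = ∫ y in (0 : ℝ)..x, f y := by
  rw [L2.inner_def, ← integral_mul_primitiveWeight _ hx]
  refine integral_congr_ae ?_
  filter_upwards [(memLp_primitiveWeight (𝕜 := 𝕜) x).coeFn_toLp] with y hy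
  rw [hy, RCLike.inner_apply, RCLike.conj_ofReal]

lemma laguerreT_laguerreL (n : ℕ) :
    laguerreT (fun x => (laguerreL n x : 𝕜)) = fun x => (laguerreL (n + 1) x : 𝕜) := by
  funext x
  rw [laguerreT, RCLike.intervalIntegral_ofReal, integral_laguerreL, laguerreL_succ]
  push_cast
  rfl

lemma laguerreT_sum_smul {ι : Type*} (s : Finset ι) (c : ι → 𝕜) (g : ι → Lp 𝕜 2 laguerreMeasure)
    (S : Lp 𝕜 2 laguerreMeasure →ₗᵢ[𝕜] Lp 𝕜 2 laguerreMeasure)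
    (h : ∀ i, S (g i) =ᵐ[laguerreMeasure] laguerreT (g i)) :
    S (∑ i ∈ s, c i • g i) =ᵐ[laguerreMeasure] laguerreT (∑ i ∈ s, c i • g i : Lp 𝕜 2 _) := by
  classical
  induction s using Finset.induction_on with
  | empty =>
    simp only [Finset.sum_empty, map_zero]
    filter_upwards [Lp.coeFn_zero 𝕜 2 laguerreMeasure, ae_laguerreMeasure_pos] with x hx hpos
    rw [laguerreT, ← inner_primitiveWeight _ hpos.le, inner_zero_right, sub_zero]
  | insert a s ha ih =>
    simp only [Finset.sum_insert ha, map_add, map_smul]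
    filter_upwards [ih, h a, ae_laguerreMeasure_pos,
      Lp.coeFn_add (c a • S (g a)) (S (∑ i ∈ s, c i • g i)), Lp.coeFn_smul (c a) (S (g a)),
      Lp.coeFn_add (c a • g a) (∑ i ∈ s, c i • g i), Lp.coeFn_smul (c a) (g a)]
      with x h1 h2 hpos h3 h4 h5 h6
    rw [h3, Pi.add_apply, h4, Pi.smul_apply, h1, h2]
    simp only [laguerreT, ← inner_primitiveWeight _ hpos.le, inner_add_right, inner_smul_right]
    rw [h5, Pi.add_apply, h6, Pi.smul_apply]
    simp only [smul_eq_mul]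
    ring

/-- Both operators agree on Laguerre partial sums. Along a subsequence the partial sums and their
shifts converge almost everywhere, while the primitives converge at each `x > 0`. -/
lemma laguerreShift_ae_eq_laguerreT (f : Lp 𝕜 2 laguerreMeasure) :
    laguerreShift 𝕜 f =ᵐ[laguerreMeasure] laguerreT f := by
  set p : ℕ → Lp 𝕜 2 laguerreMeasure := fun j =>
    ∑ k ∈ Finset.range j, (laguerreBasis 𝕜).repr f k • laguerreLp 𝕜 k with hp
  have hp_lim : Tendsto p atTop (𝓝 f) := by
    simpa only [laguerreBasis_apply] using ((laguerreBasis 𝕜).hasSum_repr f).tendsto_sum_nat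
  have hSp : ∀ j, laguerreShift 𝕜 (p j) =ᵐ[laguerreMeasure] laguerreT (p j) := by
    intro j
    refine laguerreT_sum_smul _ _ _ _ fun n => ?_
    rw [laguerreShift_laguerreLp]
    refine (coeFn_laguerreLp _).trans ?_
    rw [← laguerreT_laguerreL]
    exact (laguerreT_congr_ae (coeFn_laguerreLp n)).symm
  have hS_lim : Tendsto (fun j => laguerreShift 𝕜 (p j)) atTop (𝓝 (laguerreShift 𝕜 f)) :=
    ((laguerreShift 𝕜).continuous.tendsto f).comp hp_lim
  -- The second extraction refines the first, so both limits hold along `φ ∘ ψ`.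
  obtain ⟨φ, hφ, h1⟩ := (tendstoInMeasure_of_tendsto_Lp hp_lim).exists_seq_tendsto_ae
  obtain ⟨ψ, hψ, h2⟩ := (tendstoInMeasure_of_tendsto_Lp
    (hS_lim.comp hφ.tendsto_atTop)).exists_seq_tendsto_ae
  filter_upwards [h1, h2, ae_all_iff.2 hSp, ae_laguerreMeasure_pos] with x h1 h2 h3 hpos
  have h4 : Tendsto (fun j => ∫ y in (0 : ℝ)..x, p j y) atTop (𝓝 (∫ y in (0 : ℝ)..x, f y)) := by
    simp_rw [← inner_primitiveWeight _ hpos.le]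
    exact ((innerSL 𝕜 _).continuous.tendsto f).comp hp_lim
  refine tendsto_nhds_unique h2 ?_
  simp only [Function.comp_apply, h3]
  exact (h1.comp hψ.tendsto_atTop).sub
    (h4.comp (hφ.tendsto_atTop.comp hψ.tendsto_atTop))

lemma memLp_laguerreT {f : ℝ → 𝕜} (hf : MemLp f 2 laguerreMeasure) :
    MemLp (laguerreT f) 2 laguerreMeasure :=
  (memLp_congr_ae ((laguerreShift_ae_eq_laguerreT (hf.toLp f)).trans
    (laguerreT_congr_ae hf.coeFn_toLp))).1 (Lp.memLp _)

lemma laguerreT_iterate_ae_eq {f : ℝ → 𝕜} (hf : MemLp f 2 laguerreMeasure) (n : ℕ) :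
    laguerreT^[n] f =ᵐ[laguerreMeasure] ((laguerreShift 𝕜)^[n] (hf.toLp f) : Lp 𝕜 2 _) := by
  induction n with
  | zero => exact hf.coeFn_toLp.symm
  | succ n ih =>
    rw [Function.iterate_succ_apply', Function.iterate_succ_apply']
    exact (laguerreT_congr_ae ih).trans (laguerreShift_ae_eq_laguerreT _).symm

/-! ### Pointwise expansions and the rate of convergence -/

lemma hasSum_laguerreShift_iterate (f : Lp 𝕜 2 laguerreMeasure) (n : ℕ) :
    HasSum (fun k => laguerreCoeff f k • laguerreLp 𝕜 (k + n)) ((laguerreShift 𝕜)^[n] f) := by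
  induction n with
  | zero =>
    simpa only [laguerreBasis_apply, laguerreBasis_repr_apply, add_zero, Function.iterate_zero,
      id] using
      (laguerreBasis 𝕜).hasSum_repr f
  | succ n ih =>
    rw [Function.iterate_succ_apply']
    simpa [laguerreShift_laguerreLp, ← add_assoc] using
      ih.mapL (laguerreShift 𝕜).toContinuousLinearMap

/-- The basis vectors have norm one, so summable coefficients make the series absolutely convergent
in `L²` norm; such a series also converges almost everywhere to its sum. -/
lemma hasSum_laguerreT_iterate_ae {f : ℝ → 𝕜} (hf : MemLp f 2 laguerreMeasure)
    (hs : Summable fun n => ‖laguerreCoeff f n‖) (n : ℕ) :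
    ∀ᵐ x ∂laguerreMeasure,
      HasSum (fun k => laguerreCoeff f k * (laguerreL (k + n) x : 𝕜)) (laguerreT^[n] f x) := by
  have hc : ∀ k, laguerreCoeff (hf.toLp f) k = laguerreCoeff f k := fun k =>
    integral_congr_ae (by filter_upwards [hf.coeFn_toLp] with x hx; rw [hx])
  have h1 := hasSum_laguerreShift_iterate (hf.toLp f) n
  simp only [hc] at h1
  have h2 : Summable fun k => ‖laguerreCoeff f k • laguerreLp 𝕜 (k + n)‖ := by
    simpa [norm_smul, orthonormal_laguerreLp.1] using hs
  have h3 : ∑' k, ‖laguerreCoeff f k • laguerreLp 𝕜 (k + n)‖ₑ ≠ ⊤ :=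
    tsum_enorm_ne_top_iff_summable_norm.2 h2
  have h4 := Lp.hasSum_coeFn_tsum h3
  rw [h1.tsum_eq] at h4
  filter_upwards [h4, laguerreT_iterate_ae_eq hf n,
    ae_all_iff.2 fun k => Lp.coeFn_smul (laguerreCoeff f k) (laguerreLp 𝕜 (k + n)),
    ae_all_iff.2 fun k => coeFn_laguerreLp (𝕜 := 𝕜) (k + n)] with x h5 h6 h7 h8
  rw [h6]
  simpa only [h7, h8, Pi.smul_apply, smul_eq_mul] using h5

/-- Exchanging the sums leaves a window sum starting at `k` against each `a k`; the uniformity of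
`C` in `k` is essential here. -/
lemma norm_hasSum_le_of_laguerre {x : ℝ} {C : ℝ}
    (hC : ∀ k N : ℕ, |∑ n ∈ Finset.range N, laguerreL (k + n) x| ≤ C * √N)
    {a : ℕ → 𝕜} (ha : Summable fun k => ‖a k‖) {F : ℕ → 𝕜}
    (hF : ∀ n, HasSum (fun k => a k * (laguerreL (k + n) x : 𝕜)) (F n)) (N : ℕ) :
    ‖∑ n ∈ Finset.range N, F n‖ ≤ (∑' k, ‖a k‖) * C * √N := by
  have h1 : HasSum (fun k => a k * ((∑ n ∈ Finset.range N, laguerreL (k + n) x : ℝ) : 𝕜))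
      (∑ n ∈ Finset.range N, F n) := by
    have := hasSum_sum (s := Finset.range N) fun n _ => hF n
    simpa only [← Finset.mul_sum, ← RCLike.ofReal_sum] using this
  rw [← h1.tsum_eq, mul_assoc, ← tsum_mul_right]
  refine tsum_of_norm_bounded (ha.mul_right _).hasSum fun k => ?_
  rw [norm_mul, RCLike.norm_ofReal]
  gcongr
  exact hC k N

/-- The powers of `N` cancel exactly, leaving `C / log(1+N)^p`; hence any `p > 0` works. -/
lemma tendsto_average_of_norm_sum_le {F : ℕ → 𝕜} {C p : ℝ} (hp : 0 < p)
    (h : ∀ N : ℕ, ‖∑ n ∈ Finset.range N, F n‖ ≤ C * √N) :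
    Tendsto (fun N : ℕ => √(N : ℝ) / (Real.log (1 + (N : ℝ))) ^ p *
      ‖(N : 𝕜)⁻¹ * ∑ n ∈ Finset.range N, F n‖) atTop (𝓝 0) := by
  have hlog : Tendsto (fun N : ℕ => Real.log (1 + (N : ℝ))) atTop atTop :=
    Real.tendsto_log_atTop.comp (tendsto_atTop_add_const_left _ _ tendsto_natCast_atTop_atTop)
  have hlim : Tendsto (fun N : ℕ => C / (Real.log (1 + (N : ℝ))) ^ p) atTop (𝓝 0) :=
    tendsto_const_nhds.div_atTop ((tendsto_rpow_atTop hp).comp hlog)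
  refine tendsto_of_tendsto_of_tendsto_of_le_of_le' tendsto_const_nhds hlim ?_ ?_
  · filter_upwards with N
    have : 0 ≤ Real.log (1 + (N : ℝ)) := Real.log_nonneg (by simp)
    positivity
  · filter_upwards [eventually_gt_atTop 0] with N hN
    have hN0 : (0 : ℝ) < N := by exact_mod_cast hN
    have hl : 0 < Real.log (1 + (N : ℝ)) := Real.log_pos (by linarith)
    have hs : √(N : ℝ) * √N = N := Real.mul_self_sqrt hN0.le
    rw [norm_mul, norm_inv, RCLike.norm_natCast]
    calc √(N : ℝ) / (Real.log (1 + (N : ℝ))) ^ p * ((N : ℝ)⁻¹ * ‖∑ n ∈ Finset.range N, F n‖)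
        ≤ √(N : ℝ) / (Real.log (1 + (N : ℝ))) ^ p * ((N : ℝ)⁻¹ * (C * √N)) := by
          gcongr
          exact h N
      _ = C / (Real.log (1 + (N : ℝ))) ^ p * ((√(N : ℝ) * √N) * (N : ℝ)⁻¹) := by ring
      _ = C / (Real.log (1 + (N : ℝ))) ^ p := by rw [hs, mul_inv_cancel₀ hN0.ne', mul_one]

end

theorem corollary1p5 {𝕜 : Type*} [RCLike 𝕜] :
    -- `T` is well defined on square integrable functions and on their classes
    (∀ f : ℝ → 𝕜, MemLp f 2 laguerreMeasure →
      (∀ x : ℝ, 0 ≤ x → IntervalIntegrable f volume 0 x) ∧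
        MemLp (laguerreT f) 2 laguerreMeasure) ∧
    (∀ f g : ℝ → 𝕜, MemLp f 2 laguerreMeasure → f =ᵐ[laguerreMeasure] g →
      laguerreT f =ᵐ[laguerreMeasure] laguerreT g) ∧
    -- `T` is an isometry of `L²`, the Laguerre polynomials are an orthonormal basis of `L²`,
    -- and `T` is the unilateral shift on this basis
    (∃ (S : Lp 𝕜 2 laguerreMeasure →ₗᵢ[𝕜] Lp 𝕜 2 laguerreMeasure)
        (L : HilbertBasis ℕ 𝕜 (Lp 𝕜 2 laguerreMeasure)),
      (∀ f : Lp 𝕜 2 laguerreMeasure, S f =ᵐ[laguerreMeasure] laguerreT (f : ℝ → 𝕜)) ∧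
      (∀ n : ℕ, L n =ᵐ[laguerreMeasure] fun x => (laguerreL n x : 𝕜)) ∧
      (∀ n : ℕ, S (L n) = L (n + 1))) ∧
    -- the pointwise rate of convergence
    (∀ f : ℝ → 𝕜, MemLp f 2 laguerreMeasure →
      Summable (fun n : ℕ => ‖laguerreCoeff f n‖) →
      ∀ η : ℝ, 0 < η → ∀ᵐ x ∂laguerreMeasure,
        Tendsto (fun N : ℕ =>
          Real.sqrt (N : ℝ) / (Real.log (1 + (N : ℝ))) ^ (3 / 2 + η : ℝ) *
            ‖(N : 𝕜)⁻¹ * ∑ n ∈ Finset.range N, (laguerreT^[n] f) x‖)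
          atTop (𝓝 0)) := by
  refine ⟨fun f hf => ⟨fun x hx => intervalIntegrable_of_memLp_laguerreMeasure hf hx,
    memLp_laguerreT hf⟩, fun f g _ hfg => laguerreT_congr_ae hfg, ?_, ?_⟩
  · refine ⟨laguerreShift 𝕜, laguerreBasis 𝕜, laguerreShift_ae_eq_laguerreT, fun n => ?_,
      fun n => ?_⟩
    · rw [laguerreBasis_apply]
      exact coeFn_laguerreLp n
    · rw [laguerreBasis_apply, laguerreBasis_apply, laguerreShift_laguerreLp]
  · intro f hf hs η hη
    filter_upwards [ae_laguerreMeasure_pos, ae_all_iff.2 (hasSum_laguerreT_iterate_ae hf hs)]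
      with x hx hsum
    obtain ⟨C, -, hC⟩ := laguerreL_sum_bound hx
    exact tendsto_average_of_norm_sum_le (by positivity)
      (norm_hasSum_le_of_laguerre hC hs hsum)
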